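/- A \emph{(Kripke) frame} is a pair $F=(W,R)$ with $W$ a nonempty set and $R\subseteq W\times W$. Modal formulas are built from countably many propositional variables and $\bot,\top$ by the Boolean connectives $\land,\lor,\lnot,\to,\leftrightarrow$ and a unary modality $\Diamond$. For a valuation $\theta$ assigning a subset of $W$ to each variable, truth at points of $W$ is defined as usual; $\Diamond\varphi$ is true at $w$ iff $\varphi$ is true at some $v$ with $wRv$. A formula is \emph{valid} in $F$ if it is true at every point under every valuation. The \emph{logic} $\mathrm{Log}\,\mathcal C$ of a class $\mathcal C$ of frames is the set of all formulas valid in every frame of $\mathcal C$. A set of formulas has the \emph{finite model property} if it equals $\mathrm{Log}\,\mathcal C$ for some class $\mathcal C$ of finite frames. Let $R^0$ be the identity relation, $R^{i+1}=R^i\circ R$, and $R^*=\bigcup_{i\ge 0}R^i$. A frame $(W,R)$ is an \emph{$(m,n)$-frame} if $R^n\subseteq R^m$; it is \emph{$m$-transitive} if $R^*=\bigcup_{i\le m}R^i$. A partial order has \emph{height} $h\in\mathbb N$ if it contains a chain of cardinality $h$ and no chain of larger cardinality. The height of a frame $(W,R)$ is the height of the partially ordered set of classes of the equivalence $x\sim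 y\iff (xR^*y \text{ and } yR^*x)$, ordered by $[x]\le[y]\iff xR^*y$. \textbf{Theorem.} Let $n>m\ge 1$ and $h\ge 1$ be integers. Then the logic of each of the following four classes of frames has the finite model property: \begin{enumerate} \item the $(m,n)$-frames of height at most $h$; \item the $(m,n)$-frames of finite height; \item the $m$-transitive frames of height at most $h$; \item the $m$-transitive frames of finite height. \end{enumerate} -/

import Mathlib

universe u

namespace ModalFMP

/-- Propositional unimodal formulas over the countable set of variables `p 0, p 1, …`. -/
inductive Formula : Type
  | var : ℕ → Formula
  | bot : Formula
  | top : Formula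
  | and : Formula → Formula → Formula
  | or : Formula → Formula → Formula
  | not : Formula → Formula
  | imp : Formula → Formula → Formula
  | iff : Formula → Formula → Formula
  | dia : Formula → Formula

/-- A Kripke frame: a nonempty set with a binary relation. -/
structure Frame : Type (u + 1) where
  W : Type u
  nonempty : Nonempty W
  R : W → W → Prop

/-- Truth of a formula at a point of the model `(W, R, θ)`. -/
def Truth {W : Type u} (R : W → W → Prop) (θ : ℕ → Set W) : W → Formula → Prop
  | w, .var i => w ∈ θ i
  | _, .bot => False
  | _, .top => True
  | w, .and φ ψ => Truth R θ w φ ∧ Truth R θ w ψ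
  | w, .or φ ψ => Truth R θ w φ ∨ Truth R θ w ψ
  | w, .not φ => ¬ Truth R θ w φ
  | w, .imp φ ψ => Truth R θ w φ → Truth R θ w ψ
  | w, .iff φ ψ => (Truth R θ w φ ↔ Truth R θ w ψ)
  | w, .dia φ => ∃ v, R w v ∧ Truth R θ v φ

/-- Validity in a frame: truth at all points under all valuations. -/
def Frame.Valid (F : Frame.{u}) (φ : Formula) : Prop :=
  ∀ (θ : ℕ → Set F.W) (w : F.W), Truth F.R θ w φ

/-- The logic of a class of frames: the set of formulas valid in all frames of the class. -/
def Log (C : Set Frame.{u}) : Set Formula :=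
  {φ | ∀ F ∈ C, F.Valid φ}

/-- A set of formulas has the finite model property if it is the logic of a class of finite
frames. (Every finite frame has an isomorphic copy in `Type`.) -/
def HasFMP (L : Set Formula) : Prop :=
  ∃ C : Set Frame.{0}, (∀ F ∈ C, Finite F.W) ∧ L = Log C

/-- Powers of a relation: `R⁰` is the identity and `Rⁱ⁺¹ = Rⁱ ∘ R`. -/
def relPow {W : Type u} (R : W → W → Prop) : ℕ → W → W → Prop
  | 0 => fun x y => x = y
  | i + 1 => Relation.Comp (relPow R i) R

/-- `(m, n)`-frames: `Rⁿ ⊆ Rᵐ`. -/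
def Frame.IsMN (F : Frame.{u}) (m n : ℕ) : Prop :=
  ∀ x y, relPow F.R n x y → relPow F.R m x y

/-- `m`-transitive frames: `R* = ⋃_{i ≤ m} Rⁱ`, where `R*` is the reflexive transitive closure. -/
def Frame.IsMTransitive (F : Frame.{u}) (m : ℕ) : Prop :=
  ∀ x y, Relation.ReflTransGen F.R x y ↔ ∃ i ≤ m, relPow F.R i x y

/-- The equivalence `x ∼ y ↔ x R* y ∧ y R* x` on the points of a frame. -/
def Frame.clusterSetoid (F : Frame.{u}) : Setoid F.W where
  r x y := Relation.ReflTransGen F.R x y ∧ Relation.ReflTransGen F.R y x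
  iseqv :=
    { refl := fun _ => ⟨.refl, .refl⟩
      symm := fun h => ⟨h.2, h.1⟩
      trans := fun h₁ h₂ => ⟨h₁.1.trans h₂.1, h₂.2.trans h₁.2⟩ }

/-- The points of the skeleton of a frame: the classes (clusters) of `∼`. -/
def Frame.Skeleton (F : Frame.{u}) : Type u :=
  Quotient F.clusterSetoid

/-- The class `[x]` of a point `x`. -/
def Frame.cluster (F : Frame.{u}) (x : F.W) : F.Skeleton :=
  Quotient.mk F.clusterSetoid x

/-- The skeleton is ordered by `[x] ≤ [y] ↔ x R* y`. -/
instance Frame.instPartialOrderSkeleton (F : Frame.{u}) : PartialOrder F.Skeleton where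
  le := Quotient.lift₂ (Relation.ReflTransGen F.R) fun _ _ _ _ h₁ h₂ =>
    propext ⟨fun h => (h₁.2.trans h).trans h₂.1, fun h => (h₁.1.trans h).trans h₂.2⟩
  le_refl := by
    rintro ⟨x⟩
    exact Relation.ReflTransGen.refl
  le_trans := by
    rintro ⟨x⟩ ⟨y⟩ ⟨z⟩ h₁ h₂
    exact Relation.ReflTransGen.trans h₁ h₂
  le_antisymm := by
    rintro ⟨x⟩ ⟨y⟩ h₁ h₂
    exact Quotient.sound ⟨h₁, h₂⟩

/-- A partial order has height `h` if it has a chain of cardinality `h` and no larger chains. -/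
def PosetHasHeight (P : Type u) [PartialOrder P] (h : ℕ) : Prop :=
  (∃ s : Set P, IsChain (· ≤ ·) s ∧ s.encard = h) ∧
    ∀ s : Set P, IsChain (· ≤ ·) s → s.encard ≤ h

/-- The height of a frame is the height of its skeleton. -/
def Frame.HasHeight (F : Frame.{u}) (h : ℕ) : Prop :=
  PosetHasHeight F.Skeleton h

def Frame.FiniteHeight (F : Frame.{u}) : Prop :=
  ∃ k, F.HasHeight k

def Frame.HeightLE (F : Frame.{u}) (h : ℕ) : Prop :=
  ∃ k ≤ h, F.HasHeight k

/-- `(m, n)`-frames of height at most `h`. -/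
def classF (m n h : ℕ) : Set Frame.{u} := {F | F.IsMN m n ∧ F.HeightLE h}

/-- `(m, n)`-frames of finite height. -/
def classFStar (m n : ℕ) : Set Frame.{u} := {F | F.IsMN m n ∧ F.FiniteHeight}

/-- `m`-transitive frames of height at most `h`. -/
def classG (m h : ℕ) : Set Frame.{u} := {F | F.IsMTransitive m ∧ F.HeightLE h}

/-- `m`-transitive frames of finite height. -/
def classGStar (m : ℕ) : Set Frame.{u} := {F | F.IsMTransitive m ∧ F.FiniteHeight}

end ModalFMP

/-!
Each of the four logics is shown to be complete for the finite frames of its class, by a minimal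
filtration that respects clusters.

Suppose that `φ` fails in a model on a frame `F` of finite height. A labelling of the points of `F`
by a finite set turns the set of labels into a finite frame, in which `a` sees `b` if some point
labelled `a` sees some point labelled `b`. If the label of a point determines which subformulas of
`φ` are true at it, then truth of `φ` is preserved (`IsLiftableFiltration.truth_iff`). What has to be
arranged is that the finite frame stays in the class. For this, fix `q ≥ 1` and demand that, whenever
`a` sees `b`, *every* point labelled `a` has a path of length `≡ 1` modulo `q` to some point labelled
`b` (`IsLiftableFiltration`). Then a path of length `n` in the quotient lifts to a path of length
`kq + n`. With `q = n - m` the inclusion `Rⁿ ⊆ Rᵐ` shortens the lifted path to length `m`, so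
`(m, n)`-frames are preserved; with `q = 1` so is `m`-transitivity; and strict chains of clusters lift,
so the height does not grow.

Such a labelling is built by induction on the depth of clusters (`exists_finite_labelling`). In a
cluster all of whose strict successors are labelled already, a point gets as its local label the
true subformulas, the set of labels it sees strictly above its cluster, and the residue modulo `q`
of the length of a path to it from a fixed point of the cluster. Its label is the local label
together with the set of pairs of local labels of `R`-edges inside the cluster; there are finitely
many of these. An edge of the quotient that comes from an edge leaving a cluster lifts to an edge,
because the labels seen above are recorded. If it comes from an edge inside a cluster, then each
cluster of the same type has an edge between the same local labels, and its starting point can be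
reached by a path of length divisible by `q` from any point with the same residue
(`exists_relPow_mul_of_modEq`).
-/

namespace ModalFMP

universe v

/-! ### Powers of a relation -/

section RelPow

variable {W : Type u} {R : W → W → Prop}

lemma relPow_add {a b : ℕ} {x y z : W} (hxy : relPow R a x y) (hyz : relPow R b y z) :
    relPow R (a + b) x z := by
  induction b generalizing z with
  | zero => cases hyz; exact hxy
  | succ b ih =>
    obtain ⟨w, hw, hwz⟩ := hyz
    exact ⟨w, ih hw, hwz⟩

lemma relPow_one {x y : W} (h : R x y) : relPow R 1 x y := ⟨x, rfl, h⟩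

lemma relPow_mul_self {c : ℕ} {x : W} (h : relPow R c x x) (j : ℕ) : relPow R (j * c) x x := by
  induction j with
  | zero => rw [Nat.zero_mul]; exact rfl
  | succ j ih => rw [Nat.succ_mul]; exact relPow_add ih h

lemma reflTransGen_of_relPow {i : ℕ} {x y : W} (h : relPow R i x y) :
    Relation.ReflTransGen R x y := by
  induction i generalizing y with
  | zero => cases h; exact .refl
  | succ i ih =>
    obtain ⟨w, hw, hwy⟩ := h
    exact (ih hw).tail hwy

lemma exists_relPow_of_reflTransGen {x y : W} (h : Relation.ReflTransGen R x y) :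
    ∃ i, relPow R i x y := by
  induction h with
  | refl => exact ⟨0, rfl⟩
  | tail _ hbc ih =>
    obtain ⟨i, hi⟩ := ih
    exact ⟨i + 1, _, hi, hbc⟩

/-- If `x` lies on a closed path through `x₀`, then points reached from `x₀` by paths of lengths
congruent modulo `q` to that of a path to `x` are reached from `x` by paths of length divisible
by `q`: run `q - 1` times through the closed path, and then on from `x` through `x₀`. -/
lemma exists_relPow_mul_of_modEq {q l l' s : ℕ} {x₀ x x' : W} (hq : 0 < q)
    (hl : relPow R l x₀ x) (hl' : relPow R l' x₀ x') (hs : relPow R s x x₀)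
    (hmod : l ≡ l' [MOD q]) : ∃ k, relPow R (k * q) x x' := by
  have hpath : relPow R ((q - 1) * (s + l) + (s + l')) x x' :=
    relPow_add (relPow_mul_self (relPow_add hs hl) _) (relPow_add hs hl')
  have hdvd : q ∣ (q - 1) * (s + l) + (s + l') := by
    have h₁ : (q - 1) * (s + l) + (s + l') ≡ (q - 1) * (s + l) + (s + l) [MOD q] :=
      (hmod.symm.add_left s).add_left _
    have h₂ : (q - 1) * (s + l) + (s + l) = q * (s + l) := by
      rw [← Nat.succ_mul, Nat.succ_eq_add_one, Nat.sub_add_cancel hq]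
    rw [h₂] at h₁
    exact (h₁.dvd_iff dvd_rfl).2 (dvd_mul_right _ _)
  obtain ⟨k, hk⟩ := hdvd
  exact ⟨k, by rwa [hk, mul_comm] at hpath⟩

/-- An inclusion `R^{m+q} ⊆ Rᵐ` can be iterated. -/
lemma relPow_of_relPow_mul_add {m q : ℕ} (h : ∀ x y, relPow R (q + m) x y → relPow R m x y)
    (k : ℕ) {x y : W} (hxy : relPow R (k * q + m) x y) : relPow R m x y := by
  have hsplit : ∀ (a b : ℕ) {x z : W}, relPow R (a + b) x z →
      ∃ y, relPow R a x y ∧ relPow R b y z := by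
    intro a b
    induction b with
    | zero => exact fun h => ⟨_, h, rfl⟩
    | succ b ih =>
      rintro x z ⟨w, hw, hwz⟩
      obtain ⟨y, hxy, hyw⟩ := ih hw
      exact ⟨y, hxy, w, hyw, hwz⟩
  induction k generalizing x with
  | zero => rwa [Nat.zero_mul, Nat.zero_add] at hxy
  | succ k ih =>
    rw [Nat.succ_mul, Nat.add_assoc] at hxy
    obtain ⟨z, hxz, hzy⟩ := hsplit _ _ hxy
    exact ih (relPow_add hxz (h _ _ hzy))

end RelPow

/-! ### Height -/

/-- A partial order has height at most `h` iff it has a strictly decreasing map to the natural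
numbers below `h`; such a map serves as a measure of depth. -/
lemma exists_posetHasHeight_iff {P : Type u} [PartialOrder P] {h : ℕ} :
    (∃ k ≤ h, PosetHasHeight P k) ↔ ∃ d : P → ℕ, StrictAnti d ∧ ∀ a, d a < h := by
  constructor
  · rintro ⟨k, hk, -, hmax⟩
    have hlt : ∀ a : P, Order.coheight a < h := by
      intro a
      -- a longest strictly increasing series from `a` is a chain with one element more than its length
      have hlen : ∀ p : LTSeries P, p.length + 1 ≤ h := by
        intro p
        have hc := hmax (Set.range p) (by
          rintro _ ⟨i, rfl⟩ _ ⟨j, rfl⟩ -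
          exact (le_total i j).imp (fun hij => p.monotone hij) (fun hij => p.monotone hij))
        rw [← Set.image_univ, p.strictMono.injective.encard_image, Set.encard_univ,
          ENat.card_eq_coe_fintype_card, Fintype.card_fin] at hc
        exact (Nat.cast_le.1 hc).trans hk
      have h1 : 1 ≤ h := (Nat.le_add_left 1 _).trans (hlen (RelSeries.singleton _ a))
      have hle : Order.coheight a ≤ ((h - 1 : ℕ) : ℕ∞) := by
        refine Order.coheight_le fun p _ => ?_
        exact_mod_cast Nat.le_sub_of_add_le (hlen p)
      exact hle.trans_lt (by exact_mod_cast Nat.sub_lt h1 one_pos)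
    have hfin : ∀ a : P, Order.coheight a ≠ ⊤ := fun a => (hlt a).ne_top
    refine ⟨fun a => (Order.coheight a).toNat, fun a b hab => ?_, fun a => ?_⟩
    · have := Order.coheight_strictAnti hab (hfin b).lt_top
      rw [← ENat.natCast_toNat (hfin a), ← ENat.natCast_toNat (hfin b)] at this
      exact_mod_cast this
    · have := hlt a
      rw [← ENat.natCast_toNat (hfin a)] at this
      exact_mod_cast this
  · rintro ⟨d, hd, hlt⟩
    have hle : ∀ s : Set P, IsChain (· ≤ ·) s → s.encard ≤ h := by
      intro s hs
      have hinj : Set.InjOn d s := by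
        intro a ha b hb hab
        by_contra hne
        rcases hs ha hb hne with hle | hle
        · exact (hd (lt_of_le_of_ne hle hne)).ne hab.symm
        · exact (hd (lt_of_le_of_ne hle (Ne.symm hne))).ne hab
      calc s.encard = (d '' s).encard := hinj.encard_image.symm
        _ ≤ ((Finset.range h : Finset ℕ) : Set ℕ).encard := Set.encard_le_encard (by
            rintro _ ⟨a, -, rfl⟩
            exact Finset.mem_coe.2 (Finset.mem_range.2 (hlt a)))
        _ = h := by rw [Set.encard_coe_eq_coe_finsetCard, Finset.card_range]
    classical
    let Q : ℕ → Prop := fun k => ∃ s : Set P, IsChain (· ≤ ·) s ∧ s.encard = k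
    have hQ0 : Q 0 := ⟨∅, by simp [IsChain], by simp⟩
    refine ⟨Nat.findGreatest Q h, Nat.findGreatest_le h,
      Nat.findGreatest_spec (P := Q) (Nat.zero_le h) hQ0, fun s hs => ?_⟩
    obtain ⟨k, hk⟩ := ENat.ne_top_iff_exists.1 ((hle s hs).trans_lt (ENat.natCast_lt_top h)).ne
    have hkh : k ≤ h := by
      have := hle s hs
      rw [← hk] at this
      exact_mod_cast this
    rw [← hk]
    exact_mod_cast Nat.le_findGreatest hkh (show Q k from ⟨s, hs, hk.symm⟩)

lemma Frame.cluster_le_iff {F : Frame.{u}} {x y : F.W} :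
    F.cluster x ≤ F.cluster y ↔ Relation.ReflTransGen F.R x y := Iff.rfl

/-! ### Filtrations with liftable paths -/

/-- A surjection `f` of `F` onto `G` such that the relation of `G` is the smallest one making `f`
a homomorphism (that is, `G` is a minimal filtration of `F`), and an edge of `G` from `f x` lifts to
a path from `x` whose length is `1` modulo `q`. -/
structure IsLiftableFiltration (q : ℕ) (F : Frame.{u}) (G : Frame.{v}) (f : F.W → G.W) : Prop where
  surjective : Function.Surjective f
  rel_iff : ∀ a b, G.R a b ↔ ∃ x y, f x = a ∧ f y = b ∧ F.R x y
  exists_lift : ∀ x b, G.R (f x) b → ∃ z k, relPow F.R (k * q + 1) x z ∧ f z = b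

namespace IsLiftableFiltration

variable {q : ℕ} {F : Frame.{u}} {G : Frame.{v}} {f : F.W → G.W}

lemma relPow_map (hf : IsLiftableFiltration q F G f) {i : ℕ} {x y : F.W}
    (h : relPow F.R i x y) : relPow G.R i (f x) (f y) := by
  induction i generalizing y with
  | zero => exact congrArg f h
  | succ i ih =>
    obtain ⟨w, hw, hwy⟩ := h
    exact ⟨f w, ih hw, (hf.rel_iff _ _).2 ⟨w, y, rfl, rfl, hwy⟩⟩

lemma reflTransGen_map (hf : IsLiftableFiltration q F G f) {x y : F.W}
    (h : Relation.ReflTransGen F.R x y) : Relation.ReflTransGen G.R (f x) (f y) :=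
  let ⟨_, hi⟩ := exists_relPow_of_reflTransGen h
  reflTransGen_of_relPow (hf.relPow_map hi)

lemma exists_relPow_lift (hf : IsLiftableFiltration q F G f) {i : ℕ} {x : F.W} {b : G.W}
    (h : relPow G.R i (f x) b) : ∃ z k, relPow F.R (k * q + i) x z ∧ f z = b := by
  induction i generalizing b with
  | zero => exact ⟨x, 0, by rw [Nat.zero_mul]; exact rfl, h⟩
  | succ i ih =>
    obtain ⟨c, hc, hcb⟩ := h
    obtain ⟨y, k, hy, rfl⟩ := ih hc
    obtain ⟨z, l, hz, rfl⟩ := hf.exists_lift y b hcb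
    refine ⟨z, k + l, ?_, rfl⟩
    convert relPow_add hy hz using 1
    ring

lemma exists_reflTransGen_lift (hf : IsLiftableFiltration q F G f) {x : F.W} {b : G.W}
    (h : Relation.ReflTransGen G.R (f x) b) : ∃ z, Relation.ReflTransGen F.R x z ∧ f z = b := by
  obtain ⟨i, hi⟩ := exists_relPow_of_reflTransGen h
  obtain ⟨z, k, hz, hzb⟩ := hf.exists_relPow_lift hi
  exact ⟨z, reflTransGen_of_relPow hz, hzb⟩

lemma isMN {m n : ℕ} (hmn : m < n) (hf : IsLiftableFiltration (n - m) F G f)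
    (hF : F.IsMN m n) : G.IsMN m n := by
  intro a b hab
  obtain ⟨x, rfl⟩ := hf.surjective a
  obtain ⟨z, k, hz, rfl⟩ := hf.exists_relPow_lift hab
  have hn : n - m + m = n := Nat.sub_add_cancel hmn.le
  refine hf.relPow_map (relPow_of_relPow_mul_add (q := n - m) (by rwa [hn]) (k + 1) ?_)
  rwa [Nat.succ_mul, Nat.add_assoc, hn]

lemma isMTransitive {m : ℕ} (hf : IsLiftableFiltration q F G f) (hF : F.IsMTransitive m) :
    G.IsMTransitive m := by
  intro a b
  refine ⟨fun hab => ?_, fun ⟨i, _, hi⟩ => reflTransGen_of_relPow hi⟩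
  obtain ⟨x, rfl⟩ := hf.surjective a
  obtain ⟨z, hz, rfl⟩ := hf.exists_reflTransGen_lift hab
  obtain ⟨i, hi, hxz⟩ := (hF x z).1 hz
  exact ⟨i, hi, hf.relPow_map hxz⟩

/-- The depth of a cluster of `G` is taken to be the least depth of a point of `F` above it:
a strictly larger cluster is then reached from a point of least depth. -/
lemma heightLE {h : ℕ} (hf : IsLiftableFiltration q F G f) (hF : F.HeightLE h) : G.HeightLE h := by
  obtain ⟨d, hd, hlt⟩ := exists_posetHasHeight_iff.1 hF
  have hne : ∀ c : G.Skeleton, ∃ k x, G.cluster (f x) = c ∧ d (F.cluster x) = k := by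
    rintro ⟨a⟩
    obtain ⟨x, rfl⟩ := hf.surjective a
    exact ⟨_, x, rfl, rfl⟩
  classical
  refine exists_posetHasHeight_iff.2 ⟨fun c => Nat.find (hne c), fun a b hab => ?_, fun c => ?_⟩
  · obtain ⟨x, rfl, hx⟩ := Nat.find_spec (hne a)
    obtain ⟨b⟩ := b
    obtain ⟨z, hz, rfl⟩ := hf.exists_reflTransGen_lift (Frame.cluster_le_iff.1 hab.le)
    have hxz : F.cluster x < F.cluster z :=
      lt_of_le_not_ge (Frame.cluster_le_iff.2 hz) fun hzx =>
        hab.not_ge (Frame.cluster_le_iff.2 (hf.reflTransGen_map (Frame.cluster_le_iff.1 hzx)))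
    exact (Nat.find_min' (hne _) ⟨z, rfl, rfl⟩).trans_lt ((hd hxz).trans_eq hx)
  · obtain ⟨x, -, hx⟩ := Nat.find_spec (hne c)
    exact hx.symm.trans_lt (hlt _)

lemma finiteHeight (hf : IsLiftableFiltration q F G f) (hF : F.FiniteHeight) :
    G.FiniteHeight := by
  obtain ⟨k, hk⟩ := hF
  obtain ⟨l, -, hl⟩ := hf.heightLE ⟨k, le_rfl, hk⟩
  exact ⟨l, hl⟩

end IsLiftableFiltration

/-! ### The filtration lemma -/

/-- The set of subformulas of a formula, the formula included. -/
def Formula.subformulas : Formula → Set Formula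
  | .var i => {.var i}
  | .bot => {.bot}
  | .top => {.top}
  | .and φ ψ => insert (.and φ ψ) (φ.subformulas ∪ ψ.subformulas)
  | .or φ ψ => insert (.or φ ψ) (φ.subformulas ∪ ψ.subformulas)
  | .not φ => insert (.not φ) φ.subformulas
  | .imp φ ψ => insert (.imp φ ψ) (φ.subformulas ∪ ψ.subformulas)
  | .iff φ ψ => insert (.iff φ ψ) (φ.subformulas ∪ ψ.subformulas)
  | .dia φ => insert (.dia φ) φ.subformulas

lemma Formula.finite_subformulas (φ : Formula) : φ.subformulas.Finite := by
  induction φ with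
  | var | bot | top => exact Set.finite_singleton _
  | and _ _ h₁ h₂ | or _ _ h₁ h₂ | imp _ _ h₁ h₂ | iff _ _ h₁ h₂ => exact (h₁.union h₂).insert _
  | not _ h | dia _ h => exact h.insert _

/-- The filtration lemma. It needs the points over the same point of `G` to agree on the subformulas
of `φ` only; the image valuation may be wrong at variables that do not occur in `φ`. -/
lemma IsLiftableFiltration.truth_iff {q : ℕ} {F : Frame.{u}} {G : Frame.{v}} {f : F.W → G.W}
    (hf : IsLiftableFiltration q F G f) (θ : ℕ → Set F.W) (φ : Formula)
    (hφ : ∀ ψ ∈ φ.subformulas, ∀ x y, f x = f y → (Truth F.R θ x ψ ↔ Truth F.R θ y ψ)) (x : F.W) :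
    Truth G.R (fun i => f '' θ i) (f x) φ ↔ Truth F.R θ x φ := by
  induction φ generalizing x with
  | var i =>
    refine ⟨?_, fun h => ⟨x, h, rfl⟩⟩
    rintro ⟨y, hy, hyx⟩
    exact (hφ (.var i) rfl y x hyx).1 hy
  | bot | top => exact Iff.rfl
  | and φ ψ h₁ h₂ =>
    exact and_congr (h₁ (fun χ hχ => hφ χ (.inr (.inl hχ))) x)
      (h₂ (fun χ hχ => hφ χ (.inr (.inr hχ))) x)
  | or φ ψ h₁ h₂ =>
    exact or_congr (h₁ (fun χ hχ => hφ χ (.inr (.inl hχ))) x)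
      (h₂ (fun χ hχ => hφ χ (.inr (.inr hχ))) x)
  | not φ h => exact not_congr (h (fun χ hχ => hφ χ (.inr hχ)) x)
  | imp φ ψ h₁ h₂ =>
    exact imp_congr (h₁ (fun χ hχ => hφ χ (.inr (.inl hχ))) x)
      (h₂ (fun χ hχ => hφ χ (.inr (.inr hχ))) x)
  | iff φ ψ h₁ h₂ =>
    exact iff_congr (h₁ (fun χ hχ => hφ χ (.inr (.inl hχ))) x)
      (h₂ (fun χ hχ => hφ χ (.inr (.inr hχ))) x)
  | dia φ h =>
    have h' := h fun χ hχ => hφ χ (.inr hχ)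
    constructor
    · rintro ⟨b, hb, hbφ⟩
      obtain ⟨x', y, hx', rfl, hxy⟩ := (hf.rel_iff _ _).1 hb
      exact (hφ (.dia φ) (.inl rfl) x' x hx').1 ⟨y, hxy, (h' y).1 hbφ⟩
    · rintro ⟨y, hxy, hy⟩
      exact ⟨f y, (hf.rel_iff _ _).2 ⟨x, y, rfl, rfl, hxy⟩, (h' y).2 hy⟩

/-! ### Finite labellings of frames of finite height -/

/-- The clusters of depth less than `k` are labelled by induction on `k`. Points of larger depth
carry provisional labels. -/
lemma exists_finite_labelling (F : Frame.{u}) {q : ℕ} (hq : 0 < q) {B : Type} [Finite B]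
    (b : F.W → B) {d : F.Skeleton → ℕ} (hd : StrictAnti d) (k : ℕ) :
    ∃ (T : Type) (_ : Finite T) (t : F.W → T), (∀ x y, t x = t y → b x = b y) ∧
      ∀ x x' y', t x = t x' → d (F.cluster x) < k → d (F.cluster x') < k → F.R x' y' →
        ∃ z j, relPow F.R (j * q + 1) x z ∧ t z = t y' := by
  induction k with
  | zero => exact ⟨B, inferInstance, b, fun _ _ h => h, fun _ _ _ _ h => absurd h (Nat.not_lt_zero _)⟩
  | succ k ih =>
    obtain ⟨T, _, t, htb, ht⟩ := ih
    have : NeZero q := ⟨hq.ne'⟩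
    have hmono : ∀ {i : ℕ} {x y : F.W}, relPow F.R i x y → d (F.cluster y) ≤ d (F.cluster x) :=
      fun h => hd.antitone (Frame.cluster_le_iff.2 (reflTransGen_of_relPow h))
    -- `len x` is the length of a path to `x` from the chosen point of its cluster
    have hcl : ∀ x : F.W, ∃ l s, relPow F.R l (Quotient.out (F.cluster x)) x ∧
        relPow F.R s x (Quotient.out (F.cluster x)) := fun x => by
      obtain ⟨h₁, h₂⟩ := Quotient.exact (Quotient.out_eq (F.cluster x))
      obtain ⟨l, hl⟩ := exists_relPow_of_reflTransGen h₁
      obtain ⟨s, hs⟩ := exists_relPow_of_reflTransGen h₂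
      exact ⟨l, s, hl, hs⟩
    choose len ret hlen hret using hcl
    let loc : F.W → B × ZMod q × Set T := fun x =>
      (b x, (len x : ZMod q), {a | ∃ y, F.R x y ∧ d (F.cluster y) < k ∧ t y = a})
    let edges : F.Skeleton → Set ((B × ZMod q × Set T) × (B × ZMod q × Set T)) := fun c =>
      {p | ∃ u v, F.cluster u = c ∧ F.cluster v = c ∧ F.R u v ∧ (loc u, loc v) = p}
    classical
    let t' : F.W → T ⊕ ((B × ZMod q × Set T) ×
        Set ((B × ZMod q × Set T) × (B × ZMod q × Set T))) := fun x =>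
      if d (F.cluster x) < k then .inl (t x) else .inr (loc x, edges (F.cluster x))
    have ht'lt : ∀ {x}, d (F.cluster x) < k → t' x = .inl (t x) := fun h => if_pos h
    have ht'ge : ∀ {x}, ¬ d (F.cluster x) < k → t' x = .inr (loc x, edges (F.cluster x)) :=
      fun h => if_neg h
    refine ⟨_, inferInstance, t', fun x y hxy => ?_, fun x x' y' hxx' hx hx' hR => ?_⟩
    · by_cases hx : d (F.cluster x) < k <;> by_cases hy : d (F.cluster y) < k
      · rw [ht'lt hx, ht'lt hy] at hxy
        exact htb x y (Sum.inl_injective hxy)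
      · rw [ht'lt hx, ht'ge hy] at hxy
        cases hxy
      · rw [ht'ge hx, ht'lt hy] at hxy
        cases hxy
      · rw [ht'ge hx, ht'ge hy] at hxy
        exact congrArg (fun p => p.1.1) (Sum.inr_injective hxy)
    · by_cases hxk : d (F.cluster x) < k <;> by_cases hxk' : d (F.cluster x') < k
      · rw [ht'lt hxk, ht'lt hxk'] at hxx'
        obtain ⟨z, j, hz, hzy⟩ := ht x x' y' (Sum.inl_injective hxx') hxk hxk' hR
        refine ⟨z, j, hz, ?_⟩
        rw [ht'lt ((hmono hz).trans_lt hxk), ht'lt ((hmono (relPow_one hR)).trans_lt hxk'), hzy]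
      · rw [ht'lt hxk, ht'ge hxk'] at hxx'
        cases hxx'
      · rw [ht'ge hxk, ht'lt hxk'] at hxx'
        cases hxx'
      · rw [ht'ge hxk, ht'ge hxk'] at hxx'
        obtain ⟨hloc, hedges⟩ := Prod.ext_iff.1 (Sum.inr_injective hxx')
        dsimp only at hloc hedges
        have hle : F.cluster x' ≤ F.cluster y' := Frame.cluster_le_iff.2 (.single hR)
        rcases hle.eq_or_lt with heq | hlt
        · -- the edge stays in the cluster of `x'`; copy it to the cluster of `x`
          have hmem : (loc x', loc y') ∈ edges (F.cluster x) :=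
            hedges ▸ ⟨x', y', rfl, heq.symm, hR, rfl⟩
          obtain ⟨w, z, hw, hz, hwz, hp⟩ := hmem
          obtain ⟨hp₁, hp₂⟩ := Prod.ext_iff.1 hp
          have hres : (len x : ZMod q) = len w :=
            congrArg (fun p => p.2.1) (hloc.trans hp₁.symm)
          obtain ⟨j, hj⟩ := exists_relPow_mul_of_modEq hq (hlen x) (hw ▸ hlen w) (hret x)
            ((ZMod.natCast_eq_natCast_iff _ _ _).1 hres)
          refine ⟨z, j, relPow_add hj (relPow_one hwz), ?_⟩
          rw [ht'ge (by rwa [hz]), ht'ge (by rwa [← heq]), hz, ← heq, hedges]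
          exact congrArg (fun l => Sum.inr (l, edges (F.cluster x'))) hp₂
        · -- the edge leaves the cluster of `x'`; the label of `y'` is among those seen from `x`
          have hyk : d (F.cluster y') < k := (hd hlt).trans_le (Nat.lt_succ_iff.1 hx')
          have hmem : t y' ∈ (loc x).2.2 := by
            rw [hloc]
            exact ⟨y', hR, hyk, rfl⟩
          obtain ⟨z, hxz, hzk, hzt⟩ := hmem
          refine ⟨z, 0, by rw [Nat.zero_mul, Nat.zero_add]; exact relPow_one hxz, ?_⟩
          rw [ht'lt hzk, ht'lt hyk, hzt]

/-- Every formula refuted in a frame of finite height is refuted in a finite liftable filtration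
of this frame. -/
lemma exists_finite_filtration {F : Frame.{u}} {φ : Formula} (hF : F.FiniteHeight)
    (hφ : ¬ F.Valid φ) {q : ℕ} (hq : 0 < q) :
    ∃ (G : Frame.{0}) (f : F.W → G.W), Finite G.W ∧ IsLiftableFiltration q F G f ∧
      ¬ G.Valid φ := by
  obtain ⟨k, hk⟩ := hF
  obtain ⟨d, hd, hlt⟩ := exists_posetHasHeight_iff.1 ⟨k, le_rfl, hk⟩
  simp only [Frame.Valid, not_forall] at hφ
  obtain ⟨θ, w, hw⟩ := hφ
  have : Finite φ.subformulas := φ.finite_subformulas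
  obtain ⟨T, _, t, htb, ht⟩ := exists_finite_labelling F hq
    (fun x => {ψ : φ.subformulas | Truth F.R θ x ψ}) hd k
  let G : Frame.{0} :=
    { W := Set.range t
      nonempty := ⟨⟨t w, w, rfl⟩⟩
      R := fun a b => ∃ x y, Set.rangeFactorization t x = a ∧
        Set.rangeFactorization t y = b ∧ F.R x y }
  have hf : IsLiftableFiltration q F G (Set.rangeFactorization t) :=
    { surjective := Set.rangeFactorization_surjective
      rel_iff := fun _ _ => Iff.rfl
      exists_lift := by
        rintro x b ⟨x', y', hx', rfl, hR⟩
        obtain ⟨z, j, hz, hzy⟩ := ht x x' y' (congrArg Subtype.val hx'.symm) (hlt _) (hlt _) hR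
        exact ⟨z, j, hz, Subtype.ext hzy⟩ }
  refine ⟨G, _, inferInstanceAs (Finite (Set.range t)), hf, fun hval => hw ?_⟩
  refine (hf.truth_iff θ φ (fun ψ hψ x y hxy => ?_) w).1 (hval _ _)
  exact Set.ext_iff.1 (htb x y (congrArg Subtype.val hxy)) ⟨ψ, hψ⟩

/-! ### The finite model property -/

/-- A copy of a frame in a higher universe. -/
def Frame.lift (G : Frame.{0}) : Frame.{u} where
  W := ULift.{u} G.W
  nonempty := G.nonempty.map ULift.up
  R a b := G.R a.down b.down

lemma Frame.isLiftableFiltration_lift (q : ℕ) (G : Frame.{0}) :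
    IsLiftableFiltration q G G.lift.{u} ULift.up where
  surjective := ULift.up_surjective
  rel_iff a b := by
    refine ⟨fun h => ⟨a.down, b.down, rfl, rfl, h⟩, ?_⟩
    rintro ⟨x, y, rfl, rfl, h⟩
    exact h
  exists_lift x b h :=
    ⟨b.down, 0, by rw [Nat.zero_mul, Nat.zero_add]; exact relPow_one h, rfl⟩

/-- The finite model property of a class of frames of finite height that is closed under liftable
filtrations. The class is given by its members `C` in the universe `u` and `C₀` in the lowest one. -/
lemma hasFMP_log_of_filtration {q : ℕ} (hq : 0 < q) {C : Set Frame.{u}} {C₀ : Set Frame.{0}}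
    (hC : ∀ F ∈ C, F.FiniteHeight)
    (hdown : ∀ F ∈ C, ∀ (G : Frame.{0}) (f : F.W → G.W), IsLiftableFiltration q F G f → G ∈ C₀)
    (hup : ∀ G ∈ C₀, ∀ (F : Frame.{u}) (f : G.W → F.W), IsLiftableFiltration q G F f → F ∈ C) :
    HasFMP (Log C) := by
  refine ⟨{G | G ∈ C₀ ∧ Finite G.W}, fun _ hG => hG.2, Set.Subset.antisymm ?_ ?_⟩
  · rintro φ hφ G ⟨hG, -⟩ θ w
    have hlift := G.isLiftableFiltration_lift.{u} q
    refine (hlift.truth_iff θ φ (fun ψ _ x y hxy => ?_) w).1 (hφ _ (hup G hG _ _ hlift) _ _)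
    rw [ULift.up_injective hxy]
  · intro φ hφ F hF
    by_contra hval
    obtain ⟨G, f, hfin, hf, hG⟩ := exists_finite_filtration (hC F hF) hval hq
    exact hG (hφ G ⟨hdown F hF G f hf, hfin⟩)

end ModalFMP

open ModalFMP in
theorem mainTheorem2 (m n h : ℕ) (hm : 1 ≤ m) (hmn : m < n) (hh : 1 ≤ h) :
    ModalFMP.HasFMP (ModalFMP.Log (ModalFMP.classF.{u} m n h)) ∧
    ModalFMP.HasFMP (ModalFMP.Log (ModalFMP.classFStar.{u} m n)) ∧
    ModalFMP.HasFMP (ModalFMP.Log (ModalFMP.classG.{u} m h)) ∧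
    ModalFMP.HasFMP (ModalFMP.Log (ModalFMP.classGStar.{u} m)) := by
  have hq : 0 < n - m := Nat.sub_pos_of_lt hmn
  refine ⟨?_, ?_, ?_, ?_⟩
  · exact hasFMP_log_of_filtration (C₀ := classF m n h) hq (fun F hF => hF.2.imp fun _ hk => hk.2)
      (fun F hF G f hf => ⟨hf.isMN hmn hF.1, hf.heightLE hF.2⟩)
      (fun F hF G f hf => ⟨hf.isMN hmn hF.1, hf.heightLE hF.2⟩)
  · exact hasFMP_log_of_filtration (C₀ := classFStar m n) hq (fun F hF => hF.2)
      (fun F hF G f hf => ⟨hf.isMN hmn hF.1, hf.finiteHeight hF.2⟩)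
      (fun F hF G f hf => ⟨hf.isMN hmn hF.1, hf.finiteHeight hF.2⟩)
  · exact hasFMP_log_of_filtration (C₀ := classG m h) one_pos (fun F hF => hF.2.imp fun _ hk => hk.2)
      (fun F hF G f hf => ⟨hf.isMTransitive hF.1, hf.heightLE hF.2⟩)
      (fun F hF G f hf => ⟨hf.isMTransitive hF.1, hf.heightLE hF.2⟩)
  · exact hasFMP_log_of_filtration (C₀ := classGStar m) one_pos (fun F hF => hF.2)
      (fun F hF G f hf => ⟨hf.isMTransitive hF.1, hf.finiteHeight hF.2⟩)
      (fun F hF G f hf => ⟨hf.isMTransitive hF.1, hf.finiteHeight hF.2⟩)
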